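/- Let $M$ and $N$ be mutually dual lattices of finite rank with perfect pairing $\langle\cdot,\cdot\rangle: M\times N\to\mathbb{Z}$. Let $\sigma\subseteq N_{\mathbb{Q}}=N\otimes_{\mathbb{Z}}\mathbb{Q}$ be a finitely generated strongly convex cone, let $\sigma^\vee_M=\{m\in M : \langle m,v\rangle\ge 0 \text{ for all } v\in\sigma\}$, and let $X_\sigma=\operatorname{Spec}\mathbb{C}[\sigma^\vee_M]$ be the associated affine toric variety. Let $\sigma(1)\subseteq N$ be the set of primitive lattice vectors spanning the one-dimensional faces (rays) of $\sigma$. For $e\in M$ and $p\in N$ with $p\neq 0$, let $\partial_{e,p}$ be the derivation of $\mathbb{C}[M]$ given by $\chi^m\mapsto\langle m,p\rangle\,\chi^{m+e}$, and assume that it extends to $X_\sigma$, i.e. restricts to a derivation of $\mathbb{C}[\sigma^\vee_M]$, again denoted $\partial_{e,p}$. We say that $\partial_{e,p}$ is - of type I if $e\in\sigma^\vee_M$; - of type II if there is $\rho_e\in\sigma(1)$ such that $p\in\mathbb{Z}\rho_e$, $\langle e,\rho_e\rangle=-1$, and $\langle e,\rho\rangle\ge 0$ for all $\rho\in\sigma(1)\setminus\{\rho_e\}$.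 A vector field on $X_\sigma$ is complete if its flow exists for all complex times and all initial conditions: for each point $x\in X_\sigma(\mathbb{C})$ there is a holomorphic curve $\varphi:\mathbb{C}\to X_\sigma(\mathbb{C})$ with $\varphi(0)=x$ and $\frac{d}{dt}f(\varphi(t))=(\partial f)(\varphi(t))$ for all $t\in\mathbb{C}$ and all $f\in\mathbb{C}[\sigma^\vee_M]$. Then $\partial_{e,p}$ is of type II if and only if it is locally nilpotent on $\mathbb{C}[\sigma^\vee_M]$ (every element is annihilated by some power of $\partial_{e,p}$), and $\partial_{e,p}$ is complete on $X_\sigma$ if and only if it is of type II, or it is of type I and $\langle e,p\rangle=0$. -/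

import Mathlib

open TensorProduct
open scoped AddMonoidAlgebra

noncomputable section

namespace ToricVF

section Torus

variable {M N : Type*} [AddCommGroup M] [AddCommGroup N]

/-- The underlying linear map of the homogeneous derivation `∂_{e,p}` of `ℂ[M]`:
`χ^m ↦ ⟨m, p⟩ χ^{m+e}`, where `χ^m = AddMonoidAlgebra.single m 1`. -/
def homogeneousMap (B : M →ₗ[ℤ] N →ₗ[ℤ] ℤ) (e : M) (p : N) : ℂ[M] →ₗ[ℂ] ℂ[M] :=
  (AddMonoidAlgebra.basis M ℂ).constr ℂ fun m => AddMonoidAlgebra.single (m + e) ((B m p : ℤ) : ℂ)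

theorem homogeneousMap_single (B : M →ₗ[ℤ] N →ₗ[ℤ] ℤ) (e : M) (p : N) (m : M) (c : ℂ) :
    homogeneousMap B e p (AddMonoidAlgebra.single m c) =
      AddMonoidAlgebra.single (m + e) (c * ((B m p : ℤ) : ℂ)) := by
  have h1 : (AddMonoidAlgebra.single m c : ℂ[M]) = c • AddMonoidAlgebra.basis M ℂ m := by
    simp
  rw [h1, map_smul, homogeneousMap, Module.Basis.constr_basis]
  simp

theorem homogeneousMap_mul (B : M →ₗ[ℤ] N →ₗ[ℤ] ℤ) (e : M) (p : N) (f g : ℂ[M]) :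
    homogeneousMap B e p (f * g) =
      f • homogeneousMap B e p g + g • homogeneousMap B e p f := by
  induction f using AddMonoidAlgebra.induction_linear with
  | zero => simp
  | add f₁ f₂ h₁ h₂ =>
    rw [add_mul, map_add, h₁, h₂, map_add, add_smul, smul_add]
    abel
  | single m a =>
    induction g using AddMonoidAlgebra.induction_linear with
    | zero => simp
    | add g₁ g₂ h₁ h₂ =>
      rw [mul_add, map_add, h₁, h₂, map_add, add_smul, smul_add]
      abel
    | single k b =>
      simp only [AddMonoidAlgebra.single_mul_single, homogeneousMap_single, smul_eq_mul]
      rw [show m + (k + e) = m + k + e by abel, show k + (m + e) = m + k + e by abel,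
        ← AddMonoidAlgebra.single_add]
      congr 1
      simp only [map_add, LinearMap.add_apply, Int.cast_add]
      ring

/-- The homogeneous vector field `∂_{e,p}` on the torus `Spec ℂ[M]`, as a derivation of `ℂ[M]`:
`∂_{e,p} (χ^m) = ⟨m, p⟩ χ^{m+e}`. -/
def torusVF (B : M →ₗ[ℤ] N →ₗ[ℤ] ℤ) (e : M) (p : N) : Derivation ℂ ℂ[M] ℂ[M] :=
  Derivation.mk' (homogeneousMap B e p) (homogeneousMap_mul B e p)

end Torus

section Cone

variable {M N : Type*} [AddCommGroup M] [AddCommGroup N]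

/-- For `m : M`, the rational functional `⟨m, ·⟩` on `N_ℚ = ℚ ⊗ N`. -/
def ratPairing (B : M →ₗ[ℤ] N →ₗ[ℤ] ℤ) (m : M) : (ℚ ⊗[ℤ] N) →ₗ[ℚ] ℚ :=
  LinearMap.liftBaseChange ℚ (Algebra.linearMap ℤ ℚ ∘ₗ B m)

/-- The semigroup `σ^∨ ∩ M` of lattice points of the dual cone. -/
def dualMonoid (B : M →ₗ[ℤ] N →ₗ[ℤ] ℤ) (σ : PointedCone ℚ (ℚ ⊗[ℤ] N)) : AddSubmonoid M where
  carrier := {m | ∀ v ∈ σ, 0 ≤ ratPairing B m v}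
  zero_mem' := by
    intro v _
    simp [ratPairing]
  add_mem' := by
    intro a b ha hb v hv
    have h : ratPairing B (a + b) v = ratPairing B a v + ratPairing B b v := by
      simp [ratPairing, LinearMap.comp_add]
    rw [h]
    exact add_nonneg (ha v hv) (hb v hv)

/-- The coordinate ring `ℂ[σ^∨ ∩ M]` of the affine toric variety `X_σ`. -/
abbrev CoordRing (B : M →ₗ[ℤ] N →ₗ[ℤ] ℤ) (σ : PointedCone ℚ (ℚ ⊗[ℤ] N)) : Type _ :=
  ℂ[dualMonoid B σ]

/-- The inclusion `ℂ[σ^∨ ∩ M] → ℂ[M]`, dual to the open embedding of the torus in `X_σ`. -/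
def coordIncl (B : M →ₗ[ℤ] N →ₗ[ℤ] ℤ) (σ : PointedCone ℚ (ℚ ⊗[ℤ] N)) :
    CoordRing B σ →ₐ[ℂ] ℂ[M] :=
  AddMonoidAlgebra.mapDomainAlgHom ℂ ℂ (dualMonoid B σ).subtype

/-- A vector field `D` on `X_σ` (a derivation of its coordinate ring) extends the vector field
`∂_{e,p}` from the torus to `X_σ`. Since `coordIncl` is injective there is at most one such `D`. -/
def Extends (B : M →ₗ[ℤ] N →ₗ[ℤ] ℤ) (σ : PointedCone ℚ (ℚ ⊗[ℤ] N)) (e : M) (p : N)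
    (D : Derivation ℂ (CoordRing B σ) (CoordRing B σ)) : Prop :=
  ∀ f, coordIncl B σ (D f) = torusVF B e p (coordIncl B σ f)

/-- `ρ ∈ σ(1)`: `ρ` is a primitive lattice vector spanning a one-dimensional face of `σ`. -/
def IsRay (σ : PointedCone ℚ (ℚ ⊗[ℤ] N)) (ρ : N) : Prop :=
  (∀ (k : ℤ) (q : N), ρ = k • q → IsUnit k) ∧
    (PointedCone.hull ℚ {(1 : ℚ) ⊗ₜ[ℤ] ρ}).IsFaceOf σ

/-- Type I: `e ∈ σ^∨ ∩ M`. -/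
def IsTypeI (B : M →ₗ[ℤ] N →ₗ[ℤ] ℤ) (σ : PointedCone ℚ (ℚ ⊗[ℤ] N)) (e : M) : Prop :=
  e ∈ dualMonoid B σ

/-- Type II: for some ray `ρₑ ∈ σ(1)` one has `p ∈ ℤ ρₑ`, `⟨e, ρₑ⟩ = -1`, and `⟨e, ρ⟩ ≥ 0` for
all other rays `ρ ∈ σ(1)`. -/
def IsTypeII (B : M →ₗ[ℤ] N →ₗ[ℤ] ℤ) (σ : PointedCone ℚ (ℚ ⊗[ℤ] N)) (e : M) (p : N) : Prop :=
  ∃ ρₑ : N, IsRay σ ρₑ ∧ (∃ k : ℤ, p = k • ρₑ) ∧ B e ρₑ = -1 ∧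
    ∀ ρ : N, IsRay σ ρ → ρ ≠ ρₑ → 0 ≤ B e ρ

end Cone

section VectorField

variable {A : Type*} [CommRing A] [Algebra ℂ A]

/-- A derivation is locally nilpotent if every element is killed by some iterate. -/
def IsLocallyNilpotent (D : Derivation ℂ A A) : Prop :=
  ∀ f : A, ∃ n : ℕ, D^[n] f = 0

/-- `φ : ℂ → X(ℂ)` is an entire integral curve of the vector field `D` on `X = Spec A`, where
`X(ℂ)` is the set of `ℂ`-algebra homomorphisms `A → ℂ`: for every regular function `f` the function
`f ∘ φ` is holomorphic on `ℂ` with complex derivative `(D f) ∘ φ`. -/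
def IsEntireIntegralCurve (D : Derivation ℂ A A) (φ : ℂ → (A →ₐ[ℂ] ℂ)) : Prop :=
  ∀ (f : A) (t : ℂ), HasDerivAt (fun s => φ s f) (φ t (D f)) t

/-- The vector field `D` on `X = Spec A` is complete: its flow exists for all complex times and all
initial conditions `x ∈ X(ℂ)`. -/
def IsCompleteVF (D : Derivation ℂ A A) : Prop :=
  ∀ x : A →ₐ[ℂ] ℂ, ∃ φ : ℂ → (A →ₐ[ℂ] ℂ), φ 0 = x ∧ IsEntireIntegralCurve D φ

end VectorField

end ToricVF

end

/-! Everything rests on a dichotomy: a homogeneous derivation that extends to the toric variety is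
of type I or of type II (`Extends.isTypeI_or_isTypeII`). If e lies outside the dual cone, it is
negative on some ray ρ, because a finitely generated salient cone is generated by its rays
(`exists_isRay_pairing_neg`). For m in the facet ⟨m, ρ⟩ = 0 of the dual cone, χ^(m+e) is not
regular, so its coefficient ⟨m, p⟩ must vanish. The facet spans the hyperplane orthogonal to ρ,
hence p ∈ ℤρ. A point m with ⟨m, ρ⟩ = 1 then forces ⟨e, ρ⟩ = -1, and since p ≠ 0 determines its ray,
e is negative on no other one. The convexity input is that rays are exposed faces, which follows
from Gordan's theorem; it enters through `exists_forall_add_nsmul_mem_dualMonoid`.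

In type II each application of the derivation lowers ⟨m, ρ⟩ ≥ 0 by one and kills χ^m once this is 0.
The derivation is therefore locally nilpotent, and its exponential series, finite on every function,
is an entire flow.

In type I some monomial is never killed, so the derivation is not locally nilpotent. If ⟨e, p⟩ = 0,
then χ^e is constant along the flow, which is a one-parameter subgroup run at constant speed. If ⟨e,
p⟩ = a ≠ 0, then u = χ^e satisfies u' = a u², and the solution with u(0) = 1 blows up at time 1/a
(`ne_one_of_hasDerivAt_mul_sq`). -/

namespace ToricVF

/-! ### Finitely generated cones over an ordered field: Gordan's theorem, extremal rays, exposed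
faces. -/

section Polyhedral

variable {K V : Type*} [Field K] [LinearOrder K] [IsStrictOrderedRing K]
  [AddCommGroup V] [Module K V]

/-- **Gordan's theorem** over an ordered field: a finite family of vectors without nontrivial
nonnegative relation lies in an open half-space. -/
theorem exists_forall_pos_of_no_relation {ι : Type*} [DecidableEq ι] (s : Finset ι) (u : ι → V)
    (h : ∀ c : ι → K, (∀ i ∈ s, 0 ≤ c i) → ∑ i ∈ s, c i • u i = 0 → ∀ i ∈ s, c i = 0) :
    ∃ f : V →ₗ[K] K, ∀ i ∈ s, 0 < f (u i) := by
  induction s using Finset.induction_on generalizing u with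
  | empty => exact ⟨0, by simp⟩
  | insert j t hj ih =>
    have hrel : ∀ (a : K) (c : ι → K), 0 ≤ a → (∀ i ∈ t, 0 ≤ c i) →
        a • u j + ∑ i ∈ t, c i • u i = 0 → a = 0 ∧ ∀ i ∈ t, c i = 0 := by
      intro a c ha hc hsum
      have hne : ∀ i ∈ t, i ≠ j := fun i hi hij => hj (hij ▸ hi)
      have key := h (fun i => if i = j then a else c i)
        (by
          intro i _
          by_cases hij : i = j
          · simpa [hij] using ha
          · have : i ∈ t := by simp_all
            simpa [hij] using hc i this)
        (by
          rw [Finset.sum_insert hj, if_pos rfl, ← hsum]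
          congr 1
          exact Finset.sum_congr rfl fun i hi => by rw [if_neg (hne i hi)])
      refine ⟨by simpa using key j (by simp), fun i hi => ?_⟩
      simpa [hne i hi] using key i (by simp [hi])
    have hu : u j ≠ 0 := by
      intro h0
      exact one_ne_zero (hrel 1 0 zero_le_one (by simp) (by simp [h0])).1
    obtain ⟨g, hg⟩ := Module.Projective.exists_dual_eq_one K hu
    obtain ⟨f, hf⟩ := ih u fun c hc hsum => (hrel 0 c le_rfl hc (by simpa using hsum)).2
    rcases lt_or_ge 0 (f (u j)) with hfj | hfj
    · exact ⟨f, by simpa using ⟨hfj, hf⟩⟩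
    obtain ⟨k, hkj, hk⟩ : ∃ k : V →ₗ[K] K, k (u j) = 0 ∧ ∀ i ∈ t, 0 < k (u i) := by
      rcases hfj.eq_or_lt with hfj | hfj
      · exact ⟨f, hfj, hf⟩
      -- The vectors are projected along `u j` into the kernel of `f`. A nonnegative relation among
      -- the projections lifts to one among the original vectors, the coefficient of `u j` being
      -- nonnegative because `f (u j) < 0 < f (u i)`.
      obtain ⟨k, hk⟩ := ih (fun i => u i + (f (u i) / -f (u j)) • u j) (by
        intro c hc hsum
        refine (hrel (∑ i ∈ t, c i * (f (u i) / -f (u j))) c ?_ hc ?_).2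
        · exact Finset.sum_nonneg fun i hi =>
            mul_nonneg (hc i hi) (div_nonneg (hf i hi).le (neg_nonneg.2 hfj.le))
        · rw [← hsum, Finset.sum_smul, ← Finset.sum_add_distrib]
          exact Finset.sum_congr rfl fun i _ => by rw [smul_add, mul_smul, add_comm])
      -- This functional kills `u j`, and its value at `u i` is that of `k` at the projection of `u
      -- i`.
      refine ⟨k - (k (u j) / f (u j)) • f, ?_, fun i hi => ?_⟩
      · simp [hfj.ne]
      · have := hk i hi
        simp only [map_add, map_smul, smul_eq_mul] at this
        simp only [LinearMap.sub_apply, LinearMap.smul_apply, smul_eq_mul]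
        convert this using 1
        field_simp
        ring
    -- On `u j` only `g` contributes, with value 1; on the other vectors a large multiple of `k`
    -- outweighs `g`. Taking `C + 1` makes the inequality strict.
    obtain ⟨C, hC⟩ := (t.image fun i => -g (u i) / k (u i)).exists_le
    refine ⟨(C + 1) • k + g, ?_⟩
    simp only [Finset.mem_insert, forall_eq_or_imp, LinearMap.add_apply, LinearMap.smul_apply,
      smul_eq_mul, hkj, hg]
    refine ⟨by simp, fun i hi => ?_⟩
    have h1 := hC _ (Finset.mem_image_of_mem _ hi)
    rw [div_le_iff₀ (hk i hi)] at h1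
    have h2 := hk i hi
    linarith

/-- A finite set generates the same cone as one of its subsets that has no redundant element. -/
theorem exists_irredundant_subset [DecidableEq V] (T : Finset V) :
    ∃ T' ⊆ T, PointedCone.hull K (T' : Set V) = PointedCone.hull K (T : Set V) ∧
      ∀ v ∈ T', v ∉ PointedCone.hull K ((T'.erase v : Finset V) : Set V) := by
  induction T using Finset.strongInduction with
  | H T ih =>
    by_cases h : ∃ v ∈ T, v ∈ PointedCone.hull K ((T.erase v : Finset V) : Set V)
    · obtain ⟨v, hv, hmem⟩ := h
      obtain ⟨T', hT', hspan, hirr⟩ := ih _ (Finset.erase_ssubset hv)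
      refine ⟨T', hT'.trans (Finset.erase_subset _ _), hspan.trans ?_, hirr⟩
      have := Submodule.span_insert_eq_span hmem
      rw [← Finset.coe_insert, Finset.insert_erase hv] at this
      exact this.symm
    · exact ⟨T, subset_rfl, rfl, fun v hv hmem => h ⟨v, hv, hmem⟩⟩

theorem mem_hull_singleton {x v : V} :
    x ∈ PointedCone.hull K {v} ↔ ∃ a : K, 0 ≤ a ∧ a • v = x := by
  rw [PointedCone.hull, Submodule.mem_span_singleton]
  exact ⟨fun ⟨a, ha⟩ => ⟨a, a.2, ha⟩, fun ⟨a, h0, ha⟩ => ⟨⟨a, h0⟩, ha⟩⟩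

theorem mem_hull_insert {x v : V} {s : Set V} :
    x ∈ PointedCone.hull K (insert v s) ↔
      ∃ a : K, 0 ≤ a ∧ ∃ z ∈ PointedCone.hull K s, x = a • v + z := by
  rw [PointedCone.hull, Submodule.mem_span_insert]
  exact ⟨fun ⟨a, z, hz, ha⟩ => ⟨a, a.2, z, hz, ha⟩, fun ⟨a, h0, z, hz, ha⟩ => ⟨⟨a, h0⟩, z, hz, ha⟩⟩

theorem eq_zero_of_mem_of_neg_mem {σ : PointedCone K V} (hσ : (σ : ConvexCone K V).Salient)
    {x : V} (hx : x ∈ σ) (hx' : -x ∈ σ) : x = 0 := by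
  by_contra h
  exact hσ x hx h hx'

/-- A finitely generated salient cone is generated by finitely many nonzero vectors spanning
one-dimensional faces. -/
theorem exists_finset_isFaceOf_hull_eq {σ : PointedCone K V} (hfg : σ.FG)
    (hσ : (σ : ConvexCone K V).Salient) :
    ∃ T : Finset V, PointedCone.hull K (T : Set V) = σ ∧
      ∀ v ∈ T, v ≠ 0 ∧ (PointedCone.hull K {v}).IsFaceOf σ := by
  classical
  obtain ⟨T₀, hT₀⟩ := hfg
  obtain ⟨T, -, hT, hirr⟩ := exists_irredundant_subset (K := K) T₀
  have hTσ : PointedCone.hull K (T : Set V) = σ := hT.trans hT₀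
  refine ⟨T, hTσ, fun v hv => ⟨?_, ?_⟩⟩
  · rintro rfl
    exact hirr 0 hv (zero_mem _)
  have hvσ : v ∈ σ := hTσ ▸ PointedCone.subset_hull (Finset.mem_coe.2 hv)
  have hsub : PointedCone.hull K ((T.erase v : Finset V) : Set V) ≤ σ := by
    rw [← hTσ]
    exact Submodule.span_mono (Finset.coe_subset.2 (Finset.erase_subset _ _))
  have hdec : ∀ x ∈ σ, ∃ a : K, 0 ≤ a ∧
      ∃ z ∈ PointedCone.hull K ((T.erase v : Finset V) : Set V), x = a • v + z := by
    intro x hx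
    rwa [← hTσ, ← Finset.insert_erase hv, Finset.coe_insert, mem_hull_insert] at hx
  refine PointedCone.IsFaceOf.of_mem_of_add_mem_left ?_ ?_
  · exact Submodule.span_le.2 (by simpa using hvσ)
  intro x y hx hy hxy
  obtain ⟨a, ha, x', hx', rfl⟩ := hdec x hx
  obtain ⟨b, hb, y', hy', rfl⟩ := hdec y hy
  obtain ⟨c, hc, hcv⟩ := mem_hull_singleton.1 hxy
  have hrel : (c - a - b) • v = x' + y' := by
    rw [sub_smul, sub_smul, hcv]
    abel
  -- If the coefficient is positive, `v` is a nonnegative combination of the other generators,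
  -- against irredundancy. Otherwise `-x'` also lies in `σ`, and salience kills `x'`.
  rcases lt_or_ge 0 (c - a - b) with hpos | hneg
  · refine absurd ?_ (hirr v hv)
    have hmem := PointedCone.smul_mem _ (inv_nonneg.2 hpos.le) (add_mem hx' hy')
    rwa [← hrel, inv_smul_smul₀ hpos.ne'] at hmem
  · have h0 : x' = 0 := by
      refine eq_zero_of_mem_of_neg_mem hσ (hsub hx') ?_
      have : -x' = y' + (-(c - a - b)) • v := by
        rw [neg_smul, hrel]
        abel
      rw [this]
      exact add_mem (hsub hy') (PointedCone.smul_mem _ (neg_nonneg.2 hneg) hvσ)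
    rw [h0, add_zero]
    exact mem_hull_singleton.2 ⟨a, ha, rfl⟩

/-- A face of dimension at most one of a finitely generated cone is exposed. -/
theorem exists_exposing_functional {σ : PointedCone K V} (hfg : σ.FG) {r : V}
    (hr : (PointedCone.hull K {r}).IsFaceOf σ) :
    ∃ (T : Finset V) (f : V →ₗ[K] K), PointedCone.hull K (T : Set V) = σ ∧ f r = 0 ∧
      ∀ v ∈ T, v ∈ PointedCone.hull K {r} ∨ 0 < f v := by
  classical
  obtain ⟨T, hT⟩ := hfg
  have hTσ : ∀ v ∈ T, v ∈ σ := fun v hv => hT ▸ PointedCone.subset_hull (Finset.mem_coe.2 hv)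
  have hrσ : r ∈ σ := hr.le (PointedCone.subset_hull rfl)
  -- Gordan's theorem is applied modulo the line of `r` to the generators off the ray; the
  -- functional obtained vanishes on `r` by construction.
  obtain ⟨f, hf⟩ := exists_forall_pos_of_no_relation (K := K)
    (T.filter fun v => v ∉ PointedCone.hull K {r}) (K ∙ r).mkQ (by
      intro c hc hsum v hv
      by_contra hcv
      simp only [Finset.mem_filter] at hc hv
      have hcpos : 0 < c v := lt_of_le_of_ne (hc v hv) (Ne.symm hcv)
      simp only [← map_smul, ← map_sum] at hsum
      rw [Submodule.mkQ_apply, Submodule.Quotient.mk_eq_zero, Submodule.mem_span_singleton] at hsum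
      obtain ⟨b, hb⟩ := hsum
      rw [← Finset.add_sum_erase _ _ (by simpa using hv)] at hb
      set y := ∑ x ∈ (T.filter fun v => v ∉ PointedCone.hull K {r}).erase v, c x • x with hy
      have hyσ : y ∈ σ := Submodule.sum_mem _ fun i hi => by
        simp only [Finset.mem_erase, Finset.mem_filter] at hi
        exact PointedCone.smul_mem _ (hc i hi.2) (hTσ i hi.2.1)
      -- The relation reads `c v • v + y = b • r` with `b` of unknown sign. Adding `|b| • r` puts
      -- the right side on the ray, and the face property then puts `v` there too, a contradiction.
      have hmem : y + |b| • r ∈ σ := add_mem hyσ (PointedCone.smul_mem _ (abs_nonneg b) hrσ)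
      refine hv.2 (hr.mem_of_smul_add_mem (hTσ v hv.1) hmem hcpos ?_)
      rw [← add_assoc, ← hb, ← add_smul]
      exact mem_hull_singleton.2 ⟨b + |b|, by linarith [neg_abs_le b], rfl⟩)
  refine ⟨T, f ∘ₗ (K ∙ r).mkQ, hT, ?_, fun v hv => ?_⟩
  · rw [LinearMap.comp_apply, Submodule.mkQ_apply,
      (Submodule.Quotient.mk_eq_zero _).2 (Submodule.mem_span_singleton_self r), map_zero]
  · by_cases hvr : v ∈ PointedCone.hull K {r}
    · exact Or.inl hvr
    · exact Or.inr (hf v (by simpa using ⟨hv, hvr⟩))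

end Polyhedral

/-! ### Lattice points, primitive vectors and the perfect pairing. -/

section Lattice

variable {M N : Type*} [AddCommGroup M] [AddCommGroup N] (B : M →ₗ[ℤ] N →ₗ[ℤ] ℤ)

theorem ratPairing_tmul (m : M) (a : ℚ) (n : N) :
    ratPairing B m (a ⊗ₜ[ℤ] n) = a * ((B m n : ℤ) : ℚ) := by
  simp [ratPairing]

theorem ratPairing_add (m m' : M) : ratPairing B (m + m') = ratPairing B m + ratPairing B m' := by
  simp [ratPairing, LinearMap.comp_add]

theorem ratPairing_nsmul (k : ℕ) (m : M) : ratPairing B (k • m) = (k : ℚ) • ratPairing B m := by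
  induction k with
  | zero => ext n; simp [ratPairing]
  | succ k ih => rw [succ_nsmul, ratPairing_add, ih, Nat.cast_succ, add_smul, one_smul]

variable {B} in
theorem mem_dualMonoid_iff_of_hull_eq {σ : PointedCone ℚ (ℚ ⊗[ℤ] N)}
    {T : Set (ℚ ⊗[ℤ] N)} (hT : PointedCone.hull ℚ T = σ) {m : M} :
    m ∈ dualMonoid B σ ↔ ∀ v ∈ T, 0 ≤ ratPairing B m v := by
  refine ⟨fun h v hv => h v (hT ▸ PointedCone.subset_hull hv), fun h v hv => ?_⟩
  have : PointedCone.hull ℚ T ≤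
      PointedCone.comap (ratPairing B m) (PointedCone.positive ℚ ℚ) :=
    Submodule.span_le.2 fun v hv => by simpa using h v hv
  simpa using this (hT ▸ hv)

variable {B} in
theorem nonneg_of_mem_dualMonoid {σ : PointedCone ℚ (ℚ ⊗[ℤ] N)} {m : M}
    (hm : m ∈ dualMonoid B σ) {ρ : N}
    (hρ : (PointedCone.hull ℚ {(1 : ℚ) ⊗ₜ[ℤ] ρ}).IsFaceOf σ) : 0 ≤ B m ρ := by
  have := hm _ (hρ.le (PointedCone.subset_hull rfl))
  rw [ratPairing_tmul, one_mul] at this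
  exact_mod_cast this

/-- Clearing denominators in `ℚ ⊗ N`. -/
theorem exists_smul_eq_one_tmul (v : ℚ ⊗[ℤ] N) :
    ∃ d : ℕ, 0 < d ∧ ∃ n : N, (d : ℚ) • v = (1 : ℚ) ⊗ₜ[ℤ] n := by
  induction v using TensorProduct.induction_on with
  | zero => exact ⟨1, one_pos, 0, by simp⟩
  | tmul q n =>
    refine ⟨q.den, q.den_pos, q.num • n, ?_⟩
    rw [TensorProduct.smul_tmul', TensorProduct.tmul_smul, TensorProduct.smul_tmul', smul_eq_mul,
      Rat.den_mul_eq_num]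
    simp
  | add v w hv hw =>
    obtain ⟨c, hc, n, hn⟩ := hv
    obtain ⟨d, hd, k, hk⟩ := hw
    refine ⟨c * d, Nat.mul_pos hc hd, (d : ℤ) • n + (c : ℤ) • k, ?_⟩
    rw [smul_add, TensorProduct.tmul_add, TensorProduct.tmul_smul, TensorProduct.tmul_smul, ← hn,
      ← hk, Nat.cast_mul, mul_comm (c : ℚ), mul_smul, mul_comm (d : ℚ), mul_smul]
    simp [← Nat.cast_smul_eq_nsmul ℚ]

variable {B} in
theorem eq_of_forall_pairing_eq [B.IsPerfPair] {n n' : N} (h : ∀ m, B m n = B m n') : n = n' :=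
  (LinearMap.IsPerfPair.bijective_right B).1 (LinearMap.ext h)

/-- Every nonzero lattice vector is a positive multiple of a vector on which some functional takes
the value `1`. -/
theorem exists_eq_smul_and_pairing_eq_one [B.IsPerfPair] {n : N} (hn : n ≠ 0) :
    ∃ d : ℤ, 0 < d ∧ ∃ (q : N) (m : M), n = d • q ∧ B m q = 1 := by
  -- The values ⟨m, n⟩ form an ideal of ℤ, whose positive generator is the divisibility of `n`.
  -- Dividing ⟨·, n⟩ by it gives an integral functional, which perfectness represents by the
  -- primitive vector `q`.
  obtain ⟨d₀, hd₀⟩ := (IsPrincipalIdealRing.principal (LinearMap.range (B.flip n))).1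
  have hspan : LinearMap.range (B.flip n) = Submodule.span ℤ {|d₀|} := by
    rw [hd₀]
    exact (Int.span_natAbs d₀ ▸ by rw [Int.natCast_natAbs] : Ideal.span {d₀} = Ideal.span {|d₀|})
  set d := |d₀|
  have hdvd : ∀ m, d ∣ B m n := fun m => by
    have : B.flip n m ∈ LinearMap.range (B.flip n) := ⟨m, rfl⟩
    rw [hspan] at this
    exact Ideal.mem_span_singleton.1 this
  have hd : 0 < d := by
    refine lt_of_le_of_ne (abs_nonneg d₀) fun h0 => hn ?_
    refine eq_of_forall_pairing_eq (B := B) fun m => ?_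
    obtain ⟨c, hc⟩ := hdvd m
    rw [hc, ← h0]
    simp
  let g : M →ₗ[ℤ] ℤ :=
    { toFun := fun m => B m n / d
      map_add' := fun x y => by
        simp only [map_add, LinearMap.add_apply]
        exact Int.add_ediv_of_dvd_left (hdvd x)
      map_smul' := fun c x => by
        simp only [map_smul, LinearMap.smul_apply, smul_eq_mul, RingHom.id_apply]
        exact Int.mul_ediv_assoc _ (hdvd x) }
  obtain ⟨q, hq⟩ := (LinearMap.IsPerfPair.bijective_right B).2 g
  have hq' : ∀ m, B m q = B m n / d := fun m => LinearMap.congr_fun hq m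
  obtain ⟨m, hm⟩ : d ∈ LinearMap.range (B.flip n) := hspan ▸ Submodule.mem_span_singleton_self d
  refine ⟨d, hd, q, m, eq_of_forall_pairing_eq (B := B) fun m => ?_, ?_⟩
  · rw [map_smul, hq', smul_eq_mul, Int.mul_ediv_cancel' (hdvd m)]
  · rw [hq', show B m n = d from hm, Int.ediv_self hd.ne']

variable {B} in
-- Primitivity forces the positive factor of `exists_eq_smul_and_pairing_eq_one` to be 1; it also
-- excludes the zero vector, since 0 = 0 • 0 and 0 is not a unit.
theorem IsRay.exists_pairing_eq_one [B.IsPerfPair] {σ : PointedCone ℚ (ℚ ⊗[ℤ] N)} {ρ : N}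
    (hρ : IsRay σ ρ) : ∃ m, B m ρ = 1 := by
  have h0 : ρ ≠ 0 := by
    rintro rfl
    exact not_isUnit_zero (hρ.1 0 0 (by simp))
  obtain ⟨d, hd, q, m, rfl, hm⟩ := exists_eq_smul_and_pairing_eq_one B h0
  obtain rfl : d = 1 := (Int.isUnit_iff.1 (hρ.1 d q rfl)).resolve_right (by omega)
  exact ⟨m, by simpa using hm⟩

theorem isUnit_of_pairing_eq_one {ρ : N} {m : M} (hm : B m ρ = 1) (k : ℤ) (q : N)
    (h : ρ = k • q) : IsUnit k := by
  rw [h, map_smul, smul_eq_mul] at hm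
  exact IsUnit.of_mul_eq_one _ hm

/-- Up to a positive multiple, every rational functional on `ℚ ⊗ N` is given by a lattice point. -/
theorem exists_ratPairing_eq_smul [Module.Free ℤ N] [Module.Finite ℤ N] [B.IsPerfPair]
    (f : ℚ ⊗[ℤ] N →ₗ[ℚ] ℚ) :
    ∃ d : ℕ, 0 < d ∧ ∃ m : M, ratPairing B m = (d : ℚ) • f := by
  let b := Module.Free.chooseBasis ℤ N
  -- A common denominator for the values of `f` on a basis.
  let d : ℕ := ∏ i, (f (1 ⊗ₜ[ℤ] b i)).den
  have hd : ∀ i, ∃ z : ℤ, (z : ℚ) = d * f (1 ⊗ₜ[ℤ] b i) := fun i => by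
    obtain ⟨c, hc⟩ := Finset.dvd_prod_of_mem (fun i => (f (1 ⊗ₜ[ℤ] b i)).den) (Finset.mem_univ i)
    refine ⟨c * (f (1 ⊗ₜ[ℤ] b i)).num, ?_⟩
    rw [show d = _ from hc]
    push_cast
    rw [← Rat.den_mul_eq_num]
    ring
  choose z hz using hd
  obtain ⟨m, hm⟩ := (LinearMap.IsPerfPair.bijective_left B).2 (b.constr ℤ z)
  refine ⟨d, Finset.prod_pos fun i _ => Rat.den_pos _, m, ?_⟩
  refine (b.baseChange ℚ).ext fun i => ?_
  rw [Module.Basis.baseChange_apply, ratPairing_tmul, hm, Module.Basis.constr_basis, hz]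
  simp

variable {B} in
/-- A lattice point outside the dual cone is negative on some ray. -/
theorem exists_isRay_pairing_neg [B.IsPerfPair]
    {σ : PointedCone ℚ (ℚ ⊗[ℤ] N)} (hfg : σ.FG) (hσ : (σ : ConvexCone ℚ (ℚ ⊗[ℤ] N)).Salient)
    {e : M} (he : e ∉ dualMonoid B σ) : ∃ ρ, IsRay σ ρ ∧ B e ρ < 0 := by
  obtain ⟨T, hT, hface⟩ := exists_finset_isFaceOf_hull_eq hfg hσ
  rw [mem_dualMonoid_iff_of_hull_eq hT] at he
  push Not at he
  obtain ⟨v, hv, hneg⟩ := he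
  obtain ⟨hv0, hvface⟩ := hface v hv
  obtain ⟨d, hd, n, hn⟩ := exists_smul_eq_one_tmul v
  have hd' : (0 : ℚ) < d := by exact_mod_cast hd
  have hn0 : n ≠ 0 := by
    rintro rfl
    rw [TensorProduct.tmul_zero, smul_eq_zero] at hn
    exact hn.elim hd'.ne' hv0
  obtain ⟨k, hk, ρ, m, rfl, hm⟩ := exists_eq_smul_and_pairing_eq_one B hn0
  have hk' : (0 : ℚ) < k := by exact_mod_cast hk
  have hvρ : v = ((k : ℚ) / d) • (1 : ℚ) ⊗ₜ[ℤ] ρ := by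
    rw [div_eq_inv_mul, mul_smul, Int.cast_smul_eq_zsmul, ← TensorProduct.tmul_smul, ← hn,
      inv_smul_smul₀ hd'.ne']
  have hpos : (0 : ℚ) < (k : ℚ) / d := div_pos hk' hd'
  have hhull : PointedCone.hull ℚ {(1 : ℚ) ⊗ₜ[ℤ] ρ} = PointedCone.hull ℚ {v} := by
    refine le_antisymm (Submodule.span_le.2 ?_) (Submodule.span_le.2 ?_) <;>
      rw [Set.singleton_subset_iff, SetLike.mem_coe]
    · exact mem_hull_singleton.2 ⟨_, (inv_pos.2 hpos).le, by rw [hvρ, inv_smul_smul₀ hpos.ne']⟩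
    · exact mem_hull_singleton.2 ⟨_, hpos.le, hvρ.symm⟩
  refine ⟨ρ, ⟨isUnit_of_pairing_eq_one B hm, hhull ▸ hvface⟩, ?_⟩
  · rw [hvρ, map_smul, ratPairing_tmul, one_mul, smul_eq_mul] at hneg
    exact_mod_cast neg_of_mul_neg_right hneg hpos.le

end Lattice

/-! ### Rays of the cone and facets of its dual. -/

section Faces

variable {M N : Type*} [AddCommGroup M] [AddCommGroup N] [Module.Free ℤ N] [Module.Finite ℤ N]
  {B : M →ₗ[ℤ] N →ₗ[ℤ] ℤ} [B.IsPerfPair] {σ : PointedCone ℚ (ℚ ⊗[ℤ] N)}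

/-- A face of `σ` spanned by a lattice vector `r` is cut out by some `m₀ : M`; adding a large
multiple of `m₀` moves any functional that is nonnegative on `r` into the dual cone. -/
theorem exists_forall_add_nsmul_mem_dualMonoid (hfg : σ.FG) {r : N}
    (hr : (PointedCone.hull ℚ {(1 : ℚ) ⊗ₜ[ℤ] r}).IsFaceOf σ) :
    ∃ m₀ : M, B m₀ r = 0 ∧
      ∀ m, 0 ≤ B m r → ∃ C : ℕ, ∀ C' ≥ C, m + C' • m₀ ∈ dualMonoid B σ := by
  obtain ⟨T, f, hT, hfr, hf⟩ := exists_exposing_functional hfg hr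
  obtain ⟨d, hd, m₀, hm₀⟩ := exists_ratPairing_eq_smul B f
  have hd' : (0 : ℚ) < d := by exact_mod_cast hd
  refine ⟨m₀, ?_, fun m hm => ?_⟩
  · have := ratPairing_tmul B m₀ 1 r
    rw [hm₀, LinearMap.smul_apply, hfr] at this
    simpa using this.symm
  -- Beyond this bound the multiple of `m₀` outweighs `m` on the generators off the ray. Generators
  -- on the ray contribute only 0, by division by zero; there `m₀` vanishes and `m` is already
  -- nonnegative.
  obtain ⟨C, hC⟩ := (T.image fun v => -ratPairing B m v / ratPairing B m₀ v).exists_le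
  obtain ⟨C₀, hC₀⟩ := exists_nat_ge C
  refine ⟨C₀, fun C' hC' => (mem_dualMonoid_iff_of_hull_eq hT).2 fun v hv => ?_⟩
  rw [ratPairing_add, ratPairing_nsmul, LinearMap.add_apply, LinearMap.smul_apply, smul_eq_mul]
  rcases hf v hv with hvr | hpos
  · obtain ⟨a, ha, rfl⟩ := mem_hull_singleton.1 hvr
    rw [map_smul, map_smul, hm₀, LinearMap.smul_apply, hfr, ratPairing_tmul]
    have : (0 : ℚ) ≤ B m r := by exact_mod_cast hm
    simpa using mul_nonneg ha this
  · have hpos' : 0 < ratPairing B m₀ v := by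
      rw [hm₀]
      exact mul_pos hd' hpos
    have h1 := (hC _ (Finset.mem_image_of_mem _ hv)).trans
      (hC₀.trans (Nat.cast_le.2 hC' : (C₀ : ℚ) ≤ C'))
    rw [div_le_iff₀ hpos'] at h1
    linarith

/-- A lattice vector orthogonal to the facet of the dual cone defined by a ray is an integral
multiple of the ray. -/
theorem IsRay.exists_eq_smul_of_forall (hfg : σ.FG) {ρ : N} (hρ : IsRay σ ρ) {p : N}
    (h : ∀ m ∈ dualMonoid B σ, B m ρ = 0 → B m p = 0) : ∃ k : ℤ, p = k • ρ := by
  obtain ⟨m₀, hm₀, hm₀'⟩ := exists_forall_add_nsmul_mem_dualMonoid (B := B) hfg hρ.2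
  have hperp : ∀ m, B m ρ = 0 → B m p = 0 := by
    intro m hm
    obtain ⟨C, hC⟩ := hm₀' m hm.ge
    -- Two consecutive multiples of `m₀` both give pairing 0 with `p`; subtracting yields ⟨m₀, p⟩ =
    -- 0, and then ⟨m, p⟩ = 0.
    have h1 := h _ (hC C le_rfl) (by simp [hm, hm₀])
    have h2 := h _ (hC (C + 1) C.le_succ) (by simp [hm, hm₀])
    simp only [map_add, map_nsmul, LinearMap.add_apply, LinearMap.smul_apply, nsmul_eq_mul,
      Nat.cast_add, Nat.cast_one] at h1 h2
    have h3 : B m₀ p = 0 := by linarith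
    rw [h3] at h1
    simpa using h1
  obtain ⟨m₁, hm₁⟩ := hρ.exists_pairing_eq_one (B := B)
  -- Every m is ⟨m, ρ⟩ m₁ plus an element orthogonal to ρ, which `p` annihilates.
  refine ⟨B m₁ p, eq_of_forall_pairing_eq (B := B) fun m => ?_⟩
  have := hperp (m - B m ρ • m₁) (by simp [hm₁])
  simp only [map_sub, map_smul, LinearMap.sub_apply, LinearMap.smul_apply, smul_eq_mul] at this ⊢
  linarith

/-- A functional with value 1 on ρ is moved into the dual cone by multiples of `m₀`, which do not
change that value. -/
theorem IsRay.exists_mem_dualMonoid_pairing_eq_one (hfg : σ.FG) {ρ : N} (hρ : IsRay σ ρ) :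
    ∃ m ∈ dualMonoid B σ, B m ρ = 1 := by
  obtain ⟨m₀, hm₀, hm₀'⟩ := exists_forall_add_nsmul_mem_dualMonoid (B := B) hfg hρ.2
  obtain ⟨m₁, hm₁⟩ := hρ.exists_pairing_eq_one (B := B)
  obtain ⟨C, hC⟩ := hm₀' m₁ (by omega)
  exact ⟨_, hC C le_rfl, by simp [hm₁, hm₀]⟩

/-- The lattice points of the dual of a strongly convex cone separate the points of `N`. -/
theorem exists_mem_dualMonoid_pairing_ne_zero (hfg : σ.FG)
    (hσ : (σ : ConvexCone ℚ (ℚ ⊗[ℤ] N)).Salient) {p : N} (hp : p ≠ 0) :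
    ∃ m ∈ dualMonoid B σ, B m p ≠ 0 := by
  -- By salience the apex is a face. Taking r = 0 makes the sign condition on r vacuous, so every m
  -- enters the dual cone after adding multiples of `m₀`.
  have hface : (PointedCone.hull ℚ {(1 : ℚ) ⊗ₜ[ℤ] (0 : N)}).IsFaceOf σ := by
    refine PointedCone.IsFaceOf.of_mem_of_add_mem_left ?_ fun {x y} hx hy hxy => ?_
    · simp
    · simp only [TensorProduct.tmul_zero, Submodule.span_zero_singleton, Submodule.mem_bot] at hxy ⊢
      exact eq_zero_of_mem_of_neg_mem hσ hx (by rwa [← eq_neg_of_add_eq_zero_right hxy])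
  obtain ⟨m₀, -, hm₀⟩ := exists_forall_add_nsmul_mem_dualMonoid (B := B) hfg hface
  by_contra! h
  refine hp (eq_of_forall_pairing_eq (B := B) fun m => ?_)
  obtain ⟨C, hC⟩ := hm₀ m (by simp)
  have h1 := h _ (hC C le_rfl)
  have h2 := h _ (hC (C + 1) C.le_succ)
  simp only [map_add, map_nsmul, LinearMap.add_apply, LinearMap.smul_apply, nsmul_eq_mul,
    Nat.cast_add, Nat.cast_one] at h1 h2
  have h3 : B m₀ p = 0 := by linarith
  rw [h3] at h1
  simpa using h1

/-- Two rays with a common nonzero integral multiple agree. -/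
theorem IsRay.eq_of_smul_eq_smul (B : M →ₗ[ℤ] N →ₗ[ℤ] ℤ) [B.IsPerfPair] (hfg : σ.FG) {ρ ρ' : N}
    (hρ : IsRay σ ρ) (hρ' : IsRay σ ρ') {k k' : ℤ} (h : k • ρ = k' • ρ') (h0 : k • ρ ≠ 0) :
    ρ = ρ' := by
  obtain ⟨m, hm, hm1⟩ := hρ.exists_mem_dualMonoid_pairing_eq_one (B := B) hfg
  obtain ⟨m', hm', hm1'⟩ := hρ'.exists_mem_dualMonoid_pairing_eq_one (B := B) hfg
  have h1 := congrArg (B m) h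
  have h2 := congrArg (B m') h
  have ha := nonneg_of_mem_dualMonoid hm hρ'.2
  have hb := nonneg_of_mem_dualMonoid hm' hρ.2
  simp only [map_smul, smul_eq_mul, hm1, hm1', mul_one] at h1 h2
  have hk : k ≠ 0 := by
    rintro rfl
    simp at h0
  -- Pairing the relation with `m` and with `m'` shows that these nonnegative integers are mutually
  -- inverse, hence both equal to 1.
  have hab : B m' ρ * B m ρ' = 1 := by
    rw [← h2, mul_assoc] at h1
    exact (mul_eq_left₀ hk).1 h1.symm
  have hb1 : B m' ρ = 1 := Int.eq_one_of_mul_eq_one_right hb hab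
  rw [hb1, mul_one] at h2
  rw [← h2] at h
  exact smul_right_injective N hk h

end Faces

/-! ### Type I, type II and local nilpotency. -/

section HomogeneousDerivation

variable {M N : Type*} [AddCommGroup M] [AddCommGroup N] {B : M →ₗ[ℤ] N →ₗ[ℤ] ℤ}
  {σ : PointedCone ℚ (ℚ ⊗[ℤ] N)} {e : M} {p : N}
  {D : Derivation ℂ (CoordRing B σ) (CoordRing B σ)}

theorem coordIncl_single (m : dualMonoid B σ) (c : ℂ) :
    coordIncl B σ (AddMonoidAlgebra.single m c) = AddMonoidAlgebra.single (m : M) c := by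
  simp [coordIncl]

theorem coordIncl_injective : Function.Injective (coordIncl B σ) :=
  AddMonoidAlgebra.mapDomain_injective Subtype.val_injective

theorem coeff_coordIncl_eq_zero (f : CoordRing B σ) {m : M} (hm : m ∉ dualMonoid B σ) :
    (coordIncl B σ f).coeff m = 0 := by
  induction f using AddMonoidAlgebra.induction_linear with
  | zero => simp
  | add f g hf hg => simp [hf, hg]
  | single k c =>
    rw [coordIncl_single, AddMonoidAlgebra.coeff_single, Finsupp.single_eq_of_ne]
    rintro rfl
    exact hm k.2

theorem Extends.coordIncl_apply_single (hD : Extends B σ e p D) (m : dualMonoid B σ) (c : ℂ) :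
    coordIncl B σ (D (AddMonoidAlgebra.single m c)) =
      AddMonoidAlgebra.single ((m : M) + e) (c * ((B m p : ℤ) : ℂ)) := by
  rw [hD, coordIncl_single]
  exact homogeneousMap_single B e p m c

/-- The coefficient of χ^(m+e) in the image of χ^m is ⟨m, p⟩ ≠ 0, and regular functions are
supported in the dual monoid. This is how extendability constrains e. -/
theorem Extends.add_mem (hD : Extends B σ e p D) {m : M} (hm : m ∈ dualMonoid B σ)
    (hmp : B m p ≠ 0) : m + e ∈ dualMonoid B σ := by
  by_contra h
  have := coeff_coordIncl_eq_zero (D (AddMonoidAlgebra.single ⟨m, hm⟩ 1)) h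
  rw [hD.coordIncl_apply_single] at this
  simp at this
  exact hmp this

theorem Extends.apply_single (hD : Extends B σ e p D) (m k : dualMonoid B σ) (hk : (k : M) = m + e)
    (c : ℂ) :
    D (AddMonoidAlgebra.single m c) = AddMonoidAlgebra.single k (c * ((B m p : ℤ) : ℂ)) := by
  apply coordIncl_injective
  rw [hD.coordIncl_apply_single, coordIncl_single, hk]

theorem Extends.apply_single_of_pairing_eq_zero (hD : Extends B σ e p D) (m : dualMonoid B σ)
    (hm : B m p = 0) (c : ℂ) : D (AddMonoidAlgebra.single m c) = 0 := by
  apply coordIncl_injective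
  rw [hD.coordIncl_apply_single, hm]
  simp

theorem Extends.iterate_apply_single (hD : Extends B σ e p D) (he : e ∈ dualMonoid B σ)
    (m : dualMonoid B σ) (n : ℕ) :
    D^[n] (AddMonoidAlgebra.single m 1) = AddMonoidAlgebra.single (m + n • ⟨e, he⟩)
      (∏ i ∈ Finset.range n, ((B (m + i • e : M) p : ℤ) : ℂ)) := by
  induction n with
  | zero => simp
  | succ n ih =>
    rw [Function.iterate_succ_apply', ih, Finset.prod_range_succ]
    exact hD.apply_single _ _ (by simp [succ_nsmul, add_assoc]) _

/-- A homogeneous vector field on an affine toric variety is of type I or of type II. -/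
theorem Extends.isTypeI_or_isTypeII [Module.Free ℤ N] [Module.Finite ℤ N] [B.IsPerfPair]
    (hfg : σ.FG) (hσ : (σ : ConvexCone ℚ (ℚ ⊗[ℤ] N)).Salient) (hp : p ≠ 0)
    (hD : Extends B σ e p D) : IsTypeI B σ e ∨ IsTypeII B σ e p := by
  by_cases he : e ∈ dualMonoid B σ
  · exact Or.inl he
  have hmul : ∀ ρ, IsRay σ ρ → B e ρ < 0 → ∃ k : ℤ, p = k • ρ := by
    intro ρ hρ hneg
    -- On the facet, ⟨m, p⟩ ≠ 0 would make χ^(m+e) regular although ⟨m + e, ρ⟩ = ⟨e, ρ⟩ < 0.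
    refine hρ.exists_eq_smul_of_forall (B := B) hfg fun m hm hmρ => ?_
    by_contra hmp
    have := nonneg_of_mem_dualMonoid (hD.add_mem hm hmp) hρ.2
    rw [map_add, LinearMap.add_apply] at this
    omega
  obtain ⟨ρ, hρ, hneg⟩ := exists_isRay_pairing_neg hfg hσ he
  obtain ⟨k, hk⟩ := hmul ρ hρ hneg
  refine Or.inr ⟨ρ, hρ, ⟨k, hk⟩, ?_, fun ρ' hρ' hne => ?_⟩
  · obtain ⟨m, hm, hm1⟩ := hρ.exists_mem_dualMonoid_pairing_eq_one (B := B) hfg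
    have hmp : B m p ≠ 0 := by
      rw [hk, map_smul, hm1, smul_eq_mul, mul_one]
      rintro rfl
      exact hp (by simpa using hk)
    have := nonneg_of_mem_dualMonoid (hD.add_mem hm hmp) hρ.2
    rw [map_add, LinearMap.add_apply] at this
    omega
  · by_contra! hneg'
    obtain ⟨k', hk'⟩ := hmul ρ' hρ' hneg'
    exact hne (hρ'.eq_of_smul_eq_smul B hfg hρ (hk'.symm.trans hk) (hk' ▸ hp))

theorem IsTypeI.not_isLocallyNilpotent [Module.Free ℤ N] [Module.Finite ℤ N] [B.IsPerfPair]
    (hfg : σ.FG) (hσ : (σ : ConvexCone ℚ (ℚ ⊗[ℤ] N)).Salient) (hp : p ≠ 0)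
    (hD : Extends B σ e p D) (he : IsTypeI B σ e) : ¬ IsLocallyNilpotent D := by
  intro hnil
  -- The iterates of χ^m have the coefficients ∏ ⟨m + ie, p⟩. If ⟨e, p⟩ = 0, any m with ⟨m, p⟩ ≠ 0
  -- keeps them nonzero; otherwise m = e does, the factors being (1 + i)⟨e, p⟩.
  obtain ⟨m, hm⟩ : ∃ m : dualMonoid B σ, ∀ i : ℕ, B (m + i • e : M) p ≠ 0 := by
    by_cases hep : B e p = 0
    · obtain ⟨m, hm, hmp⟩ := exists_mem_dualMonoid_pairing_ne_zero (B := B) hfg hσ hp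
      exact ⟨⟨m, hm⟩, fun i => by simpa [hep] using hmp⟩
    · refine ⟨⟨e, he⟩, fun i => ?_⟩
      simp only [map_add, map_nsmul, LinearMap.add_apply, LinearMap.smul_apply, nsmul_eq_mul]
      rw [← one_add_mul]
      exact mul_ne_zero (by positivity) hep
  obtain ⟨n, hn⟩ := hnil (AddMonoidAlgebra.single m 1)
  rw [hD.iterate_apply_single he, AddMonoidAlgebra.single_eq_zero] at hn
  exact Finset.prod_ne_zero_iff.2 (fun i _ => Int.cast_ne_zero.2 (hm i)) hn

theorem iterate_eq_zero_of_le {A : Type*} [CommRing A] [Algebra ℂ A] (D : Derivation ℂ A A)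
    {f : A} {n k : ℕ} (hn : D^[n] f = 0) (hk : n ≤ k) : D^[k] f = 0 := by
  obtain ⟨j, rfl⟩ := Nat.exists_eq_add_of_le' hk
  rw [Function.iterate_add_apply, hn]
  exact Function.iterate_fixed (map_zero D) j

/-- Since ⟨e, ρ⟩ = -1, the derivation lowers the degree ⟨m, ρ⟩ ≥ 0 by one, and it kills degree 0
because p ∈ ℤρ. Degree j thus needs j + 1 steps. -/
theorem IsTypeII.isLocallyNilpotent (hD : Extends B σ e p D) (h : IsTypeII B σ e p) :
    IsLocallyNilpotent D := by
  obtain ⟨ρ, hρ, ⟨k, hk⟩, heρ, -⟩ := h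
  have key : ∀ (j : ℕ) (m : dualMonoid B σ), B m ρ = j →
      ∀ c : ℂ, D^[j + 1] (AddMonoidAlgebra.single m c) = 0 := by
    intro j
    induction j with
    | zero =>
      intro m hm c
      exact hD.apply_single_of_pairing_eq_zero m (by rw [hk, map_smul, hm]; simp) c
    | succ j ih =>
      intro m hm c
      rw [Function.iterate_succ_apply]
      by_cases hmp : B m p = 0
      · rw [hD.apply_single_of_pairing_eq_zero m hmp c]
        exact Function.iterate_fixed (map_zero D) _
      · rw [hD.apply_single m ⟨m + e, hD.add_mem m.2 hmp⟩ rfl]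
        exact ih _ (by simp [hm, heρ]) _
  intro f
  induction f using AddMonoidAlgebra.induction_linear with
  | zero => exact ⟨0, rfl⟩
  | add f g hf hg =>
    obtain ⟨a, ha⟩ := hf
    obtain ⟨b, hb⟩ := hg
    exact ⟨max a b, by
      rw [iterate_map_add, iterate_eq_zero_of_le D ha (le_max_left a b),
        iterate_eq_zero_of_le D hb (le_max_right a b), add_zero]⟩
  | single m c =>
    obtain ⟨j, hj⟩ := Int.eq_ofNat_of_zero_le (nonneg_of_mem_dualMonoid m.2 hρ.2)
    exact ⟨j + 1, key j m hj c⟩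

end HomogeneousDerivation

/-! ### Exponentials of locally nilpotent derivations, and blow-up of u' = a u². -/

section Flows

variable {A : Type*} [CommRing A] [Algebra ℂ A]

theorem iterate_derivation_mul (D : Derivation ℂ A A) (n : ℕ) (f g : A) :
    D^[n] (f * g) =
      ∑ ij ∈ Finset.HasAntidiagonal.antidiagonal n, n.choose ij.1 • (D^[ij.1] f * D^[ij.2] g) := by
  induction n with
  | zero => simp
  | succ n ih =>
    rw [Finset.sum_antidiagonal_choose_succ_nsmul (fun i j => D^[i] f * D^[j] g) n]
    simp only [Function.iterate_succ_apply', ih, map_sum, map_nsmul, Derivation.leibniz,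
      smul_eq_mul, smul_add, Finset.sum_add_distrib, add_right_inj]
    refine Finset.sum_congr rfl fun ⟨i, j⟩ hij => ?_
    rw [n.choose_symm_of_eq_add (Finset.HasAntidiagonal.mem_antidiagonal.1 hij).symm, mul_comm]

/-- The Taylor coefficients, multiplied by `t ^ n`, of a regular function along the flow of `D`. -/
noncomputable def flowTerm (D : Derivation ℂ A A) (x : A →ₐ[ℂ] ℂ) (t : ℂ) (f : A) (n : ℕ) : ℂ :=
  t ^ n / n.factorial * x (D^[n] f)

/-- The factorials absorb the binomial coefficients of the Leibniz rule, leaving a Cauchy product;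
this makes the exponential multiplicative. -/
theorem flowTerm_mul (D : Derivation ℂ A A) (x : A →ₐ[ℂ] ℂ) (t : ℂ) (f g : A) (n : ℕ) :
    flowTerm D x t (f * g) n =
      ∑ ij ∈ Finset.HasAntidiagonal.antidiagonal n, flowTerm D x t f ij.1 * flowTerm D x t g ij.2 := by
  rw [flowTerm, iterate_derivation_mul, map_sum, Finset.mul_sum]
  refine Finset.sum_congr rfl fun ⟨i, j⟩ hij => ?_
  obtain rfl := Finset.HasAntidiagonal.mem_antidiagonal.1 hij
  have h1 : ((i + j).choose i : ℂ) * i.factorial * j.factorial = (i + j).factorial := by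
    have := Nat.choose_mul_factorial_mul_factorial (Nat.le_add_right i j)
    rw [Nat.add_sub_cancel_left] at this
    exact_mod_cast this
  have hi : (i.factorial : ℂ) ≠ 0 := by exact_mod_cast i.factorial_ne_zero
  have hj : (j.factorial : ℂ) ≠ 0 := by exact_mod_cast j.factorial_ne_zero
  have hij : ((i + j).factorial : ℂ) ≠ 0 := by exact_mod_cast (i + j).factorial_ne_zero
  simp only [flowTerm, map_mul, nsmul_eq_mul, map_natCast, pow_add]
  field_simp
  rw [← h1]
  ring

theorem flowTerm_eq_zero {D : Derivation ℂ A A} (x : A →ₐ[ℂ] ℂ) (t : ℂ) {f : A} {k n : ℕ}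
    (hk : D^[k] f = 0) (hn : k ≤ n) : flowTerm D x t f n = 0 := by
  rw [flowTerm, iterate_eq_zero_of_le D hk hn, map_zero, mul_zero]

theorem tsum_flowTerm {D : Derivation ℂ A A} (x : A →ₐ[ℂ] ℂ) (t : ℂ) {f : A} {k : ℕ}
    (hk : D^[k] f = 0) : ∑' n, flowTerm D x t f n = ∑ n ∈ Finset.range k, flowTerm D x t f n :=
  tsum_eq_sum fun _ hn => flowTerm_eq_zero x t hk (by simpa using hn)

theorem summable_norm_flowTerm {D : Derivation ℂ A A} (hD : IsLocallyNilpotent D)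
    (x : A →ₐ[ℂ] ℂ) (t : ℂ) (f : A) : Summable fun n => ‖flowTerm D x t f n‖ := by
  obtain ⟨k, hk⟩ := hD f
  refine summable_of_ne_finset_zero (s := Finset.range k) fun n hn => ?_
  rw [flowTerm_eq_zero x t hk (by simpa using hn), norm_zero]

/-- The time-`t` flow `exp (t D)` of a locally nilpotent vector field, applied to a point `x`. -/
noncomputable def nilpotentFlow {D : Derivation ℂ A A} (hD : IsLocallyNilpotent D) (x : A →ₐ[ℂ] ℂ)
    (t : ℂ) : A →ₐ[ℂ] ℂ :=
  AlgHom.ofLinearMap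
    -- Each series is finite, but its length depends on f; the infinite sum avoids choosing a
    -- cutoff.
    { toFun := fun f => ∑' n, flowTerm D x t f n
      map_add' := fun f g => by
        rw [← (summable_norm_flowTerm hD x t f).of_norm.tsum_add
          (summable_norm_flowTerm hD x t g).of_norm]
        simp only [flowTerm, iterate_map_add, map_add, mul_add]
      map_smul' := fun c f => by
        rw [RingHom.id_apply, smul_eq_mul, ← tsum_mul_left]
        refine tsum_congr fun n => ?_
        have : D^[n] (c • f) = c • D^[n] f := by
          clear * -
          induction n with
          | zero => rfl
          | succ n ih => simp only [Function.iterate_succ_apply', ih, D.map_smul]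
        rw [flowTerm, this, map_smul, smul_eq_mul, flowTerm]
        ring }
    (by
      have : D^[1] (1 : A) = 0 := by simp
      change ∑' n, flowTerm D x t 1 n = 1
      rw [tsum_flowTerm x t this]
      simp [flowTerm])
    (fun f g => by
      change ∑' n, flowTerm D x t (f * g) n = _
      rw [tsum_congr (flowTerm_mul D x t f g)]
      exact (tsum_mul_tsum_eq_tsum_sum_antidiagonal_of_summable_norm
        (summable_norm_flowTerm hD x t f) (summable_norm_flowTerm hD x t g)).symm)

theorem nilpotentFlow_apply {D : Derivation ℂ A A} (hD : IsLocallyNilpotent D) (x : A →ₐ[ℂ] ℂ)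
    (t : ℂ) {f : A} {k : ℕ} (hk : D^[k] f = 0) :
    nilpotentFlow hD x t f = ∑ n ∈ Finset.range k, flowTerm D x t f n :=
  tsum_flowTerm x t hk

/-- Locally nilpotent vector fields are complete. -/
theorem IsLocallyNilpotent.isCompleteVF {D : Derivation ℂ A A} (hD : IsLocallyNilpotent D) :
    IsCompleteVF D := by
  refine fun x => ⟨nilpotentFlow hD x, ?_, fun f t => ?_⟩
  · ext f
    obtain ⟨k, hk⟩ := hD f
    rw [nilpotentFlow_apply hD x 0 (iterate_eq_zero_of_le D hk k.le_succ), Finset.sum_range_succ']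
    simp [flowTerm]
  · obtain ⟨k, hk⟩ := hD f
    -- The sum for `f` is given one more term than the one for `D f`, so that after splitting off
    -- the constant term n = 0 the derivative matches term by term.
    have hk1 := iterate_eq_zero_of_le D hk k.le_succ
    simp only [nilpotentFlow_apply hD x _ hk1]
    rw [nilpotentFlow_apply hD x t (k := k) (by rwa [← Function.iterate_succ_apply])]
    simp only [Finset.sum_range_succ' _ k]
    have h0 : HasDerivAt (fun s => flowTerm D x s f 0) 0 t := by
      simpa [flowTerm] using hasDerivAt_const t (x f)
    rw [← add_zero (∑ n ∈ Finset.range k, flowTerm D x t (D f) n)]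
    refine HasDerivAt.add (HasDerivAt.fun_sum fun n _ => ?_) h0
    have h1 := ((hasDerivAt_pow (n + 1) t).div_const ((n + 1).factorial : ℂ)).mul_const
      (x (D^[n + 1] f))
    refine h1.congr_deriv ?_
    rw [flowTerm, Function.iterate_succ_apply, Nat.factorial_succ]
    have : (n.factorial : ℂ) ≠ 0 := by exact_mod_cast n.factorial_ne_zero
    have : (n + 1 : ℂ) ≠ 0 := by exact_mod_cast n.succ_ne_zero
    push_cast
    field_simp

/-- Along an entire solution of `u' = a u²` with `a ≠ 0` the initial value is not `1`. -/
theorem ne_one_of_hasDerivAt_mul_sq {a : ℂ} (ha : a ≠ 0) {u : ℂ → ℂ}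
    (hu : ∀ t, HasDerivAt u (a * u t ^ 2) t) : u 0 ≠ 1 := by
  intro h0
  -- The solution with u(0) = 1 would be u(s/a) = 1/(1 - s), and `w` measures the failure of this.
  -- It satisfies the linear equation w' = u w with w(0) = 0, so it vanishes on [0, 1] by Grönwall's
  -- inequality, whereas w(1) = -1.
  let w : ℝ → ℂ := fun s => u (s / a) * (1 - s) - 1
  have hw : ∀ s : ℝ, HasDerivAt w (u (s / a) * w s) s := by
    intro s
    have h1 : HasDerivAt (fun s : ℝ => (s : ℂ) / a) (1 / a) s :=
      (Complex.ofRealCLM.hasDerivAt (x := s)).div_const a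
    have h2 := (hu (s / a)).comp s h1
    have h3 : HasDerivAt (fun s : ℝ => (1 : ℂ) - s) (-1) s :=
      (Complex.ofRealCLM.hasDerivAt (x := s)).const_sub 1
    refine ((h2.mul h3).sub_const 1).congr_deriv ?_
    simp only [w, Function.comp_apply]
    field_simp
    ring
  have hcont : Continuous fun s : ℝ => u (s / a) :=
    (continuous_iff_continuousAt.2 fun t => (hu t).continuousAt).comp (by fun_prop)
  obtain ⟨K, hK⟩ := isCompact_Icc.exists_bound_of_continuousOn (s := Set.Icc (0 : ℝ) 1)
    hcont.continuousOn
  have := eq_zero_of_abs_deriv_le_mul_abs_self_of_eq_zero_right (f := w) (K := K) (a := 0) (b := 1)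
    (fun s _ => (hw s).continuousAt.continuousWithinAt) (fun s _ => (hw s).hasDerivWithinAt)
    (by simp [w, h0])
    (fun s hs => by
      rw [norm_mul]
      exact mul_le_mul_of_nonneg_right (hK s (Set.Ico_subset_Icc_self hs)) (norm_nonneg _))
    1 (by simp)
  simp [w] at this

end Flows

/-! ### Completeness in type I. -/

section Completeness

variable {M N : Type*} [AddCommGroup M] [AddCommGroup N] {B : M →ₗ[ℤ] N →ₗ[ℤ] ℤ}
  {σ : PointedCone ℚ (ℚ ⊗[ℤ] N)} {e : M} {p : N}
  {D : Derivation ℂ (CoordRing B σ) (CoordRing B σ)}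

/-- The flow of `∂_{e,p}` for `e ∈ σ^∨` and `⟨e, p⟩ = 0`: the one-parameter subgroup `p` acting
with speed `χ^e`. -/
noncomputable def semisimpleFlow (p : N) (x : CoordRing B σ →ₐ[ℂ] ℂ) (c t : ℂ) :
    CoordRing B σ →ₐ[ℂ] ℂ :=
  AddMonoidAlgebra.lift ℂ ℂ (dualMonoid B σ)
    { toFun := fun m => x (AddMonoidAlgebra.single m.toAdd 1) *
        Complex.exp (t * (((B m.toAdd p : ℤ) : ℂ) * c))
      map_one' := by
        change x 1 * _ = 1
        simp
      map_mul' := fun m k => by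
        have : (AddMonoidAlgebra.single (m * k).toAdd 1 : CoordRing B σ) =
            AddMonoidAlgebra.single m.toAdd 1 * AddMonoidAlgebra.single k.toAdd 1 := by
          rw [AddMonoidAlgebra.single_mul_single, one_mul, toAdd_mul]
        rw [this, map_mul, toAdd_mul, AddSubmonoid.coe_add, map_add, LinearMap.add_apply,
          Int.cast_add, add_mul, mul_add, Complex.exp_add]
        ring }

theorem semisimpleFlow_single (x : CoordRing B σ →ₐ[ℂ] ℂ) (c t : ℂ) (m : dualMonoid B σ) (b : ℂ) :
    semisimpleFlow p x c t (AddMonoidAlgebra.single m b) =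
      b * (x (AddMonoidAlgebra.single m 1) * Complex.exp (t * (((B m p : ℤ) : ℂ) * c))) := by
  rw [semisimpleFlow, AddMonoidAlgebra.lift_single]
  rfl

/-- As ⟨e, p⟩ = 0, the function χ^e keeps its initial value c along the flow, so each χ^m obeys the
linear equation f' = ⟨m, p⟩ c f. -/
theorem IsTypeI.isCompleteVF (hD : Extends B σ e p D) (he : IsTypeI B σ e) (hep : B e p = 0) :
    IsCompleteVF D := by
  intro x
  set E : dualMonoid B σ := ⟨e, he⟩
  refine ⟨semisimpleFlow p x (x (AddMonoidAlgebra.single E 1)), ?_, fun f t => ?_⟩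
  · ext m
    simp [semisimpleFlow_single]
  induction f using AddMonoidAlgebra.induction_linear with
  | zero => simpa using hasDerivAt_const t (0 : ℂ)
  | add f g hf hg => simpa only [map_add] using hf.fun_add hg
  | single m b =>
    rw [hD.apply_single m (m + E) rfl]
    simp only [semisimpleFlow_single]
    have hsplit : (AddMonoidAlgebra.single (m + E) 1 : CoordRing B σ) =
        AddMonoidAlgebra.single m 1 * AddMonoidAlgebra.single E 1 := by
      rw [AddMonoidAlgebra.single_mul_single, one_mul]
    have hB : B ((m + E : dualMonoid B σ) : M) p = B m p := by
      simp [E, hep]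
    rw [hB, hsplit, map_mul]
    have h1 := ((((hasDerivAt_id t).mul_const
      (((B m p : ℤ) : ℂ) * x (AddMonoidAlgebra.single E 1))).cexp).const_mul
      (x (AddMonoidAlgebra.single m 1))).const_mul b
    refine h1.congr_deriv ?_
    simp only [id]
    ring

/-- The unit of the torus, as a point of the toric variety. -/
noncomputable def unitPoint (B : M →ₗ[ℤ] N →ₗ[ℤ] ℤ) (σ : PointedCone ℚ (ℚ ⊗[ℤ] N)) :
    CoordRing B σ →ₐ[ℂ] ℂ :=
  AddMonoidAlgebra.lift ℂ ℂ (dualMonoid B σ) 1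

/-- The derivation sends χ^e to ⟨e, p⟩ (χ^e)², so along the integral curve through the unit point,
where χ^e = 1, the function χ^e would be an entire solution of an equation that blows up. -/
theorem IsTypeI.pairing_eq_zero_of_isCompleteVF (hD : Extends B σ e p D) (he : IsTypeI B σ e)
    (hc : IsCompleteVF D) : B e p = 0 := by
  by_contra hep
  obtain ⟨φ, hφ0, hφ⟩ := hc (unitPoint B σ)
  set E : dualMonoid B σ := ⟨e, he⟩
  refine ne_one_of_hasDerivAt_mul_sq (Int.cast_ne_zero.2 hep : ((B e p : ℤ) : ℂ) ≠ 0)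
    (u := fun t => φ t (AddMonoidAlgebra.single E 1)) (fun t => ?_) ?_
  · have h := hφ (AddMonoidAlgebra.single E 1) t
    have hsq : D (AddMonoidAlgebra.single E 1) =
        ((B e p : ℤ) : ℂ) • (AddMonoidAlgebra.single E 1) ^ 2 := by
      rw [hD.apply_single E (E + E) rfl, sq, AddMonoidAlgebra.single_mul_single,
        AddMonoidAlgebra.smul_single]
      simp [E]
    rwa [hsq, map_smul, map_pow, smul_eq_mul] at h
  · simp [hφ0, unitPoint]

end Completeness

end ToricVF

theorem mainTheorem10 {M N : Type*} [AddCommGroup M] [Module.Free ℤ M] [Module.Finite ℤ M]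
    [AddCommGroup N] [Module.Free ℤ N] [Module.Finite ℤ N]
    (B : M →ₗ[ℤ] N →ₗ[ℤ] ℤ) [B.IsPerfPair]
    (σ : PointedCone ℚ (ℚ ⊗[ℤ] N)) (hσfg : σ.FG)
    (hσ : (σ : ConvexCone ℚ (ℚ ⊗[ℤ] N)).Salient)
    (e : M) (p : N) (hp : p ≠ 0)
    (D : Derivation ℂ (ToricVF.CoordRing B σ) (ToricVF.CoordRing B σ))
    (hD : ToricVF.Extends B σ e p D) :
    (ToricVF.IsTypeII B σ e p ↔ ToricVF.IsLocallyNilpotent D) ∧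
    (ToricVF.IsCompleteVF D ↔
      ToricVF.IsTypeII B σ e p ∨ (ToricVF.IsTypeI B σ e ∧ B e p = 0)) := by
  have htype := hD.isTypeI_or_isTypeII hσfg hσ hp
  refine ⟨⟨fun h => h.isLocallyNilpotent hD, fun h => ?_⟩, fun h => ?_, ?_⟩
  · exact htype.resolve_left fun he => he.not_isLocallyNilpotent hσfg hσ hp hD h
  · exact htype.symm.imp_right fun he => ⟨he, he.pairing_eq_zero_of_isCompleteVF hD h⟩
  · rintro (h | ⟨he, hep⟩)
    · exact (h.isLocallyNilpotent hD).isCompleteVF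
    · exact he.isCompleteVF hD hep
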